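/- A numerical semigroup is an additive submonoid $S$ of $\mathbb{N}=\{0,1,2,\dots\}$ with finite complement $\mathcal{G}=\mathbb{N}\setminus S$. Its Frobenius number $\mathrm{F}(S)$ is the largest element of $\mathcal{G}$ (with $\mathrm{F}(\mathbb{N})=-1$), its embedding dimension is the number of elements of its unique minimal set of generators, and its semigroup polynomial is $$\mathrm{P}_S(x)=1+(x-1)\sum_{g\in\mathcal{G}}x^g\in\mathbb{Z}[x].$$ The semigroup $S$ is symmetric if $S\cup(\mathrm{F}(S)-S)=\mathbb{Z}$, where $\mathrm{F}(S)-S=\{\mathrm{F}(S)-s : s\in S\}$. A Kronecker polynomial is a monic polynomial in $\mathbb{Z}[x]$ all of whose complex roots lie in the closed unit disc, and $S$ is cyclotomic if $\mathrm{P}_S$ is a Kronecker polynomial. Theorem. (a) For every integer $k\ge 4$ there is a symmetric numerical semigroup with embedding dimension $k$ that is not cyclotomic. (b) For every odd integer $F\ge 9$ there is a symmetric numerical semigroup with Frobenius number $F$ that is not cyclotomic. -/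

import Mathlib

/-- A numerical semigroup: an additive submonoid of `ℕ` with finite complement. -/
structure NumericalSemigroup extends AddSubmonoid ℕ where
  finite_compl : carrierᶜ.Finite

namespace NumericalSemigroup

/-- The (finite) set of gaps, i.e. of the nonnegative integers that are not in `S`. -/
noncomputable def gaps (S : NumericalSemigroup) : Finset ℕ := S.finite_compl.toFinset

/-- The Frobenius number: the largest integer that is not in `S`. It is the largest gap when
`S ≠ ℕ`, and it is `-1` when `S = ℕ`. -/
noncomputable def frobeniusNumber (S : NumericalSemigroup) : ℤ :=
  sSup (((↑) : ℕ → ℤ) '' S.carrier)ᶜ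

theorem isGreatest_frobeniusNumber (S : NumericalSemigroup) :
    IsGreatest (((↑) : ℕ → ℤ) '' S.carrier)ᶜ S.frobeniusNumber := by
  have hne : ((((↑) : ℕ → ℤ) '' S.carrier)ᶜ).Nonempty := by
    refine ⟨-1, ?_⟩
    rintro ⟨n, -, hn⟩
    omega
  have hbdd : BddAbove ((((↑) : ℕ → ℤ) '' S.carrier)ᶜ) := by
    obtain ⟨B, hB⟩ := S.finite_compl.bddAbove
    refine ⟨(B : ℤ), fun z hz => ?_⟩
    by_contra! h
    lift z to ℕ using by omega
    have : z ∈ S.carrierᶜ := fun hs => hz ⟨z, hs, rfl⟩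
    have := hB this
    omega
  exact ⟨Int.csSup_mem hne hbdd, fun z hz => le_csSup hbdd hz⟩

/-- For nonnegative values this is Mathlib's predicate `FrobeniusNumber`. -/
theorem frobeniusNumber_eq_natCast_iff (S : NumericalSemigroup) (n : ℕ) :
    S.frobeniusNumber = n ↔ FrobeniusNumber n S.carrier := by
  have hcl : AddSubmonoid.closure S.carrier = S.toAddSubmonoid :=
    AddSubmonoid.closure_eq S.toAddSubmonoid
  have hG := S.isGreatest_frobeniusNumber
  rw [frobeniusNumber_iff, hcl]
  constructor
  · intro h
    rw [h] at hG
    refine ⟨fun hn => hG.1 ⟨n, hn, rfl⟩, fun k hk => ?_⟩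
    by_contra hkS
    have : (k : ℤ) ∈ (((↑) : ℕ → ℤ) '' S.carrier)ᶜ := by
      rintro ⟨m, hm, hmk⟩
      have : m = k := by exact_mod_cast hmk
      exact hkS (this ▸ hm)
    have := hG.2 this
    omega
  · rintro ⟨h1, h2⟩
    refine hG.unique ⟨?_, fun z hz => ?_⟩
    · rintro ⟨m, hm, hmk⟩
      have : m = n := by exact_mod_cast hmk
      exact h1 (this ▸ hm)
    · by_contra! h
      lift z to ℕ using by omega
      exact hz ⟨z, h2 z (by omega), rfl⟩

/-- The minimal generators of `S`: its nonzero elements that are not the sum of two nonzero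
elements of `S`. -/
def minimalGenerators (S : NumericalSemigroup) : Set ℕ :=
  {n | n ∈ S.carrier ∧ n ≠ 0 ∧
    ∀ a ∈ S.carrier, ∀ b ∈ S.carrier, a ≠ 0 → b ≠ 0 → a + b ≠ n}

theorem minimalGenerators_subset (S : NumericalSemigroup) {A : Set ℕ}
    (hA : AddSubmonoid.closure A = S.toAddSubmonoid) : S.minimalGenerators ⊆ A := by
  rintro n ⟨hn, hn0, hn2⟩
  have key : ∀ y ∈ AddSubmonoid.closure A, y = 0 ∨ y ∈ A ∨
      ∃ a ∈ S.carrier, ∃ b ∈ S.carrier, a ≠ 0 ∧ b ≠ 0 ∧ a + b = y := by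
    intro y hy
    induction hy using AddSubmonoid.closure_induction with
    | mem x hx => exact Or.inr (Or.inl hx)
    | zero => exact Or.inl rfl
    | add x y hx hy ihx ihy =>
      rw [hA] at hx hy
      by_cases hx0 : x = 0
      · simpa [hx0] using ihy
      by_cases hy0 : y = 0
      · simpa [hy0] using ihx
      exact Or.inr (Or.inr ⟨x, hx, y, hy, hx0, hy0, rfl⟩)
  have hnA : n ∈ AddSubmonoid.closure A := by rw [hA]; exact hn
  rcases key n hnA with h | h | ⟨a, ha, b, hb, ha0, hb0, hab⟩
  · exact absurd h hn0
  · exact h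
  · exact absurd hab (hn2 a ha b hb ha0 hb0)

theorem closure_minimalGenerators (S : NumericalSemigroup) :
    AddSubmonoid.closure S.minimalGenerators = S.toAddSubmonoid := by
  apply le_antisymm
  · exact (AddSubmonoid.closure_le).2 fun n hn => hn.1
  · intro n
    induction n using Nat.strong_induction_on with
    | _ n ih =>
      intro hn
      by_cases hn0 : n = 0
      · rw [hn0]; exact zero_mem _
      by_cases hmin : n ∈ S.minimalGenerators
      · exact AddSubmonoid.subset_closure hmin
      · have : ∃ a ∈ S.carrier, ∃ b ∈ S.carrier, a ≠ 0 ∧ b ≠ 0 ∧ a + b = n := by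
          by_contra! h
          exact hmin ⟨hn, hn0, fun a ha b hb ha0 hb0 => h a ha b hb ha0 hb0⟩
        obtain ⟨a, ha, b, hb, ha0, hb0, rfl⟩ := this
        exact add_mem (ih a (by omega) ha) (ih b (by omega) hb)

/-- `S.minimalGenerators` is the unique minimal set of generators of `S`. -/
theorem minimal_generating_iff (S : NumericalSemigroup) (A : Set ℕ) :
    Minimal (fun B : Set ℕ => AddSubmonoid.closure B = S.toAddSubmonoid) A ↔
      A = S.minimalGenerators := by
  constructor
  · intro h
    exact (h.eq_of_superset S.closure_minimalGenerators (S.minimalGenerators_subset h.prop))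
  · rintro rfl
    exact ⟨S.closure_minimalGenerators, fun B hB _ => S.minimalGenerators_subset hB⟩

theorem finite_minimalGenerators (S : NumericalSemigroup) : S.minimalGenerators.Finite := by
  obtain ⟨T, hT⟩ := Nat.addSubmonoid_fg S.toAddSubmonoid
  exact T.finite_toSet.subset (S.minimalGenerators_subset hT)

/-- The embedding dimension: the number of minimal generators. -/
noncomputable def embeddingDimension (S : NumericalSemigroup) : ℕ :=
  S.minimalGenerators.ncard

/-- `S` is symmetric if `S ∪ (F(S) - S) = ℤ`, where `F(S)` is the Frobenius number. -/
def IsSymmetric (S : NumericalSemigroup) : Prop :=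
  (((↑) : ℕ → ℤ) '' S.carrier) ∪ ((fun s : ℕ => S.frobeniusNumber - (s : ℤ)) '' S.carrier) =
    Set.univ

/-- The semigroup polynomial `P_S(x) = 1 + (x - 1) ∑ x ^ g`, the sum being over the gaps. -/
noncomputable def semigroupPolynomial (S : NumericalSemigroup) : Polynomial ℤ :=
  1 + (Polynomial.X - 1) * ∑ g ∈ S.gaps, Polynomial.X ^ g

end NumericalSemigroup

/-- A Kronecker polynomial: a monic integer polynomial all of whose complex roots lie in the
closed unit disc. -/
def IsKronecker (f : Polynomial ℤ) : Prop :=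
  f.Monic ∧ ∀ z : ℂ, Polynomial.aeval z f = 0 → ‖z‖ ≤ 1

/-- `S` is cyclotomic if its semigroup polynomial is a Kronecker polynomial. -/
def NumericalSemigroup.IsCyclotomic (S : NumericalSemigroup) : Prop :=
  IsKronecker S.semigroupPolynomial

/-! Both parts use the semigroup `punctured n` with `n ≥ 5`, whose gaps are 1, …, n - 1 and 2n - 1:
it is symmetric, has embedding dimension n - 1 and Frobenius number 2n - 1, and its semigroup
polynomial is `gapPolynomial ℤ n`. If all 2n complex roots lay in the closed unit disc, every power
sum of the roots would have norm at most 2n. Newton's identities (`newton_powerSeries`) give a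
recurrence for the power sums, and running it up to exponent 2n + 3 yields the value 2n + 4, a
contradiction. -/

/-! ### Newton's identities -/

open Polynomial in
/-- **Newton's identities** for a multiset `s` in generating function form: if
`Q = ∏ (1 - z X)`, then `|s| Q - X Q' = Q ∑ pₘ X ^ m`, where `pₘ` are the power sums of `s`. -/
theorem newton_powerSeries {R : Type*} [CommRing R] (s : Multiset R) :
    ((s.card : R[X]) * (s.map fun z => 1 - C z * X).prod -
        X * derivative (s.map fun z => 1 - C z * X).prod : R[X]) =
      ((s.map fun z => 1 - C z * X).prod : R[X]) *
        PowerSeries.mk (fun m => (s.map fun z => z ^ m).sum) := by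
  induction s using Multiset.induction_on with
  | empty =>
    have : PowerSeries.mk (fun _ : ℕ => (0 : R)) = 0 := by ext; simp
    simp [this]
  | cons z s ih =>
    have hgeom : ((1 - C z * X : R[X]) : PowerSeries R) * PowerSeries.mk (fun m => z ^ m) = 1 := by
      ext m
      cases m with
      | zero => simp [sub_mul, mul_assoc]
      | succ m =>
        simp [sub_mul, mul_assoc, PowerSeries.coeff_succ_X_mul, PowerSeries.coeff_one, pow_succ']
    have hadd : PowerSeries.mk (fun m => ((z ::ₘ s).map fun w => w ^ m).sum) =
        PowerSeries.mk (fun m => z ^ m) + PowerSeries.mk (fun m => (s.map fun w => w ^ m).sum) := by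
      ext m; simp
    rw [hadd]
    simp only [Multiset.map_cons, Multiset.prod_cons, Multiset.card_cons, derivative_mul,
      derivative_sub, derivative_one, derivative_C, derivative_X]
    set Q := (s.map fun z => 1 - C z * X).prod
    push_cast at ih hgeom ⊢
    linear_combination ((1 : PowerSeries R) - PowerSeries.C z * PowerSeries.X) * ih -
      (Q : PowerSeries R) * hgeom

open Polynomial in
/-- The reverse of a monic polynomial over an algebraically closed field, in terms of its roots. -/
theorem reverse_eq_prod_roots {K : Type*} [Field K] [IsAlgClosed K] {f : K[X]} (hf : f.Monic) :
    f.reverse = (f.roots.map fun z => 1 - C z * X).prod := by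
  have hlin : ∀ z : K, (X - C z).reverse = 1 - C z * X := fun z => by
    rw [reverse, natDegree_X_sub_C, sub_eq_add_neg, ← C_neg, reflect_add, reflect_C,
      ← pow_one (X : K[X]), reflect_monomial]
    simp [revAt_le, sub_eq_add_neg]
  have hprod : ∀ s : Multiset K, ((s.map fun z => X - C z).prod).reverse =
      (s.map fun z => 1 - C z * X).prod := fun s => by
    induction s using Multiset.induction_on with
    | empty => simpa using reverse_C (1 : K)
    | cons z s ih =>
      rw [Multiset.map_cons, Multiset.prod_cons, reverse_mul_of_domain, ih, hlin]
      simp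
  conv_lhs => rw [(IsAlgClosed.splits f).eq_prod_roots_of_monic hf]
  exact hprod _

/-! ### Power sums of the roots of the gap polynomial -/

section SelfReciprocal

open Polynomial

variable (R : Type*) [CommRing R] (n : ℕ)

/-- The polynomial `1 - X + X ^ n - X ^ (2 n - 1) + X ^ (2 n)`. -/
noncomputable def gapPolynomial : R[X] := 1 - X + X ^ n - X ^ (2 * n - 1) + X ^ (2 * n)

variable {R n}

theorem natDegree_gapPolynomial [Nontrivial R] (hn : 2 ≤ n) :
    (gapPolynomial R n).natDegree = 2 * n := by
  have h : (1 - X + X ^ n - X ^ (2 * n - 1) : R[X]).natDegree < 2 * n := by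
    refine lt_of_le_of_lt (b := 2 * n - 1) ?_ (by omega)
    refine natDegree_le_iff_coeff_eq_zero.2 fun m hm => ?_
    simp only [coeff_add, coeff_sub, coeff_one, coeff_X, coeff_X_pow]
    rw [if_neg (by omega), if_neg (by omega), if_neg (by omega), if_neg (by omega)]
    ring
  rw [gapPolynomial, natDegree_add_eq_right_of_natDegree_lt (by simpa using h), natDegree_X_pow]

theorem monic_gapPolynomial (hn : 2 ≤ n) : (gapPolynomial R n).Monic := by
  nontriviality R
  rw [Monic, leadingCoeff, natDegree_gapPolynomial hn, gapPolynomial]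
  simp only [coeff_add, coeff_sub, coeff_one, coeff_X, coeff_X_pow]
  rw [if_neg (by omega), if_neg (by omega), if_neg (by omega), if_neg (by omega)]
  simp

theorem reverse_gapPolynomial [Nontrivial R] (hn : 2 ≤ n) :
    (gapPolynomial R n).reverse = gapPolynomial R n := by
  ext m
  rw [coeff_reverse, natDegree_gapPolynomial hn]
  rcases lt_or_ge (2 * n) m with h | h
  · rw [revAt_eq_self_of_lt h]
  · rw [revAt_le h]
    simp only [gapPolynomial, coeff_add, coeff_sub, coeff_one, coeff_X, coeff_X_pow]
    have h1 : 2 * n - m = 0 ↔ m = 2 * n := by omega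
    have h2 : 1 = 2 * n - m ↔ m = 2 * n - 1 := by omega
    have h3 : 2 * n - m = n ↔ m = n := by omega
    have h4 : 2 * n - m = 2 * n - 1 ↔ 1 = m := by omega
    have h5 : 2 * n - m = 2 * n ↔ m = 0 := by omega
    simp only [h1, h2, h3, h4, h5]
    ring

/-- The power sums of the complex roots of `gapPolynomial ℂ n`. -/
noncomputable def gapPowerSum (n m : ℕ) : ℂ := ((gapPolynomial ℂ n).roots.map fun z => z ^ m).sum

theorem card_roots_gapPolynomial (hn : 2 ≤ n) : (gapPolynomial ℂ n).roots.card = 2 * n := by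
  rw [← natDegree_gapPolynomial (R := ℂ) hn]
  exact (splits_iff_card_roots).1 (IsAlgClosed.splits _)

theorem gapPowerSum_zero (hn : 2 ≤ n) : gapPowerSum n 0 = 2 * n := by
  simp [gapPowerSum, card_roots_gapPolynomial hn]

/-- Compare coefficients in `newton_powerSeries`. The product there is the reverse of the
polynomial, hence the polynomial itself by self-reciprocity. The conditions guard the truncated
subtractions. -/
theorem gapPowerSum_recurrence (hn : 2 ≤ n) (m : ℕ) :
    gapPowerSum n (m + 1) = gapPowerSum n m
      - (if n ≤ m + 1 then gapPowerSum n (m + 1 - n) else 0)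
      + (if 2 * n - 1 ≤ m + 1 then gapPowerSum n (m + 1 - (2 * n - 1)) else 0)
      - (if 2 * n ≤ m + 1 then gapPowerSum n (m + 1 - 2 * n) else 0)
      + (2 * n - (m + 1)) * (gapPolynomial ℂ n).coeff (m + 1) := by
  have key := newton_powerSeries (gapPolynomial ℂ n).roots
  rw [← reverse_eq_prod_roots (monic_gapPolynomial hn), reverse_gapPolynomial hn,
    card_roots_gapPolynomial hn] at key
  have hL : PowerSeries.coeff (m + 1)
      ((((2 * n : ℕ) : ℂ[X]) * gapPolynomial ℂ n - X * derivative (gapPolynomial ℂ n) : ℂ[X]) :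
        PowerSeries ℂ) = (2 * n - (m + 1)) * (gapPolynomial ℂ n).coeff (m + 1) := by
    rw [Polynomial.coeff_coe, coeff_sub, coeff_X_mul, coeff_derivative, coeff_natCast_mul]
    push_cast
    ring
  have hR := congrArg (PowerSeries.coeff (m + 1)) key
  rw [hL] at hR
  rw [hR]
  conv_rhs => enter [2, 2, 1]; rw [gapPolynomial]
  simp only [coe_add, coe_sub, coe_one, coe_X, coe_pow, add_mul, sub_mul, one_mul, map_add,
    map_sub, PowerSeries.coeff_succ_X_mul, PowerSeries.coeff_X_pow_mul', PowerSeries.coeff_mk]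
  simp only [gapPowerSum]
  ring

theorem coeff_gapPolynomial (m : ℕ) : (gapPolynomial R n).coeff m =
    (if m = 0 then 1 else 0) - (if 1 = m then 1 else 0) + (if m = n then 1 else 0)
      - (if m = 2 * n - 1 then 1 else 0) + (if m = 2 * n then 1 else 0) := by
  simp only [gapPolynomial, coeff_add, coeff_sub, coeff_one, coeff_X, coeff_X_pow]

theorem gapPowerSum_of_lt (hn : 2 ≤ n) {m : ℕ} (h1 : 1 ≤ m) (h2 : m < n) :
    gapPowerSum n m = 1 := by
  induction m, h1 using Nat.le_induction with
  | base =>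
    have h := gapPowerSum_recurrence hn 0
    rw [coeff_gapPolynomial, gapPowerSum_zero hn] at h
    rw [zero_add] at h
    rw [h, if_neg (by omega), if_neg (by omega), if_neg (by omega), if_neg (by omega),
      if_pos (by omega), if_neg (by omega), if_neg (by omega), if_neg (by omega)]
    push_cast
    ring
  | succ m hm ih =>
    rw [gapPowerSum_recurrence hn m, coeff_gapPolynomial, ih (by omega),
      if_neg (by omega), if_neg (by omega), if_neg (by omega), if_neg (by omega),
      if_neg (by omega), if_neg (by omega), if_neg (by omega), if_neg (by omega)]
    ring

/-- In this range the term `X ^ n` is active as well and subtracts an earlier power sum equal to 1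
at each step after the first. -/
theorem gapPowerSum_of_ge (hn : 2 ≤ n) {m : ℕ} (h1 : n ≤ m) (h2 : m < 2 * n - 1) :
    gapPowerSum n m = 1 - m := by
  induction m, h1 using Nat.le_induction with
  | base =>
    obtain ⟨m, rfl⟩ : ∃ m, n = m + 1 := ⟨n - 1, by omega⟩
    rw [gapPowerSum_recurrence hn m, coeff_gapPolynomial, Nat.sub_self, gapPowerSum_zero hn,
      gapPowerSum_of_lt hn (m := m) (by omega) (by omega), if_pos (by omega),
      if_neg (by omega), if_neg (by omega), if_neg (by omega), if_neg (by omega),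
      if_pos rfl, if_neg (by omega), if_neg (by omega)]
    push_cast
    ring
  | succ m hm ih =>
    rw [gapPowerSum_recurrence hn m, coeff_gapPolynomial, ih (by omega),
      gapPowerSum_of_lt hn (m := m + 1 - n) (by omega) (by omega), if_pos (by omega),
      if_neg (by omega), if_neg (by omega), if_neg (by omega), if_neg (by omega),
      if_neg (by omega), if_neg (by omega), if_neg (by omega)]
    push_cast
    ring

theorem gapPowerSum_two_mul_sub_one (hn : 3 ≤ n) : gapPowerSum n (2 * n - 1) = 1 := by
  obtain ⟨m, hm⟩ : ∃ m, 2 * n - 1 = m + 1 := ⟨2 * n - 2, by omega⟩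
  have hmn : (m : ℂ) = 2 * n - 2 := by
    rw [eq_sub_iff_add_eq]; exact_mod_cast (by omega : m + 2 = 2 * n)
  have h := gapPowerSum_recurrence (n := n) (by omega) m
  rw [coeff_gapPolynomial, ← hm, Nat.sub_self, gapPowerSum_zero (by omega),
    gapPowerSum_of_ge (m := m) (by omega) (by omega) (by omega),
    gapPowerSum_of_lt (m := 2 * n - 1 - n) (by omega) (by omega) (by omega), if_pos (by omega),
    if_pos le_rfl, if_neg (by omega), if_neg (by omega), if_neg (by omega), if_neg (by omega),
    if_pos rfl, if_neg (by omega), hmn] at h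
  rw [h]
  ring

/-- The power sums of degree at least `2 n` satisfy a linear recurrence. -/
theorem gapPowerSum_two_mul_add (hn : 2 ≤ n) (j : ℕ) :
    gapPowerSum n (2 * n + j) = gapPowerSum n (2 * n + j - 1) - gapPowerSum n (n + j)
      + gapPowerSum n (j + 1) - gapPowerSum n j := by
  obtain ⟨m, hm⟩ : ∃ m, 2 * n + j = m + 1 := ⟨2 * n + j - 1, by omega⟩
  have h := gapPowerSum_recurrence (n := n) (by omega) m
  -- At degree 2n the first factor vanishes; beyond it the coefficient does.
  have hc : (2 * n - (m + 1)) * (gapPolynomial ℂ n).coeff (m + 1) = 0 := by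
    rcases Nat.eq_zero_or_pos j with rfl | hj
    · have : (2 * n : ℂ) = m + 1 := by exact_mod_cast hm
      rw [this]; ring
    · rw [coeff_eq_zero_of_natDegree_lt (by rw [natDegree_gapPolynomial hn]; omega), mul_zero]
  rw [hc, ← hm, if_pos (by omega), if_pos (by omega), if_pos (by omega), add_zero,
    show 2 * n + j - n = n + j by omega, show 2 * n + j - (2 * n - 1) = j + 1 by omega,
    show 2 * n + j - 2 * n = j by omega] at h
  rw [h, hm, Nat.add_sub_cancel]

/-- From exponent 2n on, the values are 1 - n, 1, n + 2, 2n + 4. The last step uses the closed forms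
at exponents n + 3 and 4, which is why `5 ≤ n` is needed. -/
theorem gapPowerSum_two_mul_add_three (hn : 5 ≤ n) : gapPowerSum n (2 * n + 3) = 2 * n + 4 := by
  have h2 : 2 ≤ n := by omega
  have hlo : ∀ m, 1 ≤ m → m < n → gapPowerSum n m = 1 := fun m => gapPowerSum_of_lt h2
  have hhi : ∀ j, j < n - 1 → gapPowerSum n (n + j) = 1 - (n + j) := fun j hj => by
    rw [gapPowerSum_of_ge h2 (by omega) (by omega)]; push_cast; rfl
  have e0 := gapPowerSum_two_mul_add h2 0
  have e1 := gapPowerSum_two_mul_add h2 1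
  have e2 := gapPowerSum_two_mul_add h2 2
  have e3 := gapPowerSum_two_mul_add h2 3
  rw [hhi _ (by omega), hlo (0 + 1) (by omega) (by omega), gapPowerSum_zero h2, add_zero,
    gapPowerSum_two_mul_sub_one (by omega)] at e0
  rw [hhi _ (by omega), hlo (1 + 1) (by omega) (by omega), hlo 1 (by omega) (by omega),
    Nat.add_sub_cancel] at e1
  rw [hhi _ (by omega), hlo (2 + 1) (by omega) (by omega), hlo 2 (by omega) (by omega),
    show 2 * n + 2 - 1 = 2 * n + 1 by omega] at e2
  rw [hhi _ (by omega), hlo (3 + 1) (by omega) (by omega), hlo 3 (by omega) (by omega),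
    show 2 * n + 3 - 1 = 2 * n + 2 by omega] at e3
  push_cast at e0 e1 e2 e3
  linear_combination e0 + e1 + e2 + e3

/-- The power sum of degree `2 n + 3` exceeds the number of roots. -/
theorem not_isKronecker_gapPolynomial (hn : 5 ≤ n) : ¬ IsKronecker (gapPolynomial ℤ n) := by
  rintro ⟨-, hroots⟩
  have hmap : (gapPolynomial ℤ n).map (Int.castRingHom ℂ) = gapPolynomial ℂ n := by
    simp [gapPolynomial]
  have hle : ‖gapPowerSum n (2 * n + 3)‖ ≤ 2 * n := by
    have hbound : ∀ x ∈ ((gapPolynomial ℂ n).roots.map fun z => z ^ (2 * n + 3)).map norm,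
        x ≤ 1 := by
      intro x hx
      simp only [Multiset.mem_map] at hx
      obtain ⟨_, ⟨z, hz, rfl⟩, rfl⟩ := hx
      rw [norm_pow]
      refine pow_le_one₀ (norm_nonneg z) (hroots z ?_)
      have := isRoot_of_mem_roots hz
      rwa [← hmap, IsRoot.def, eval_map, ← algebraMap_int_eq, ← aeval_def] at this
    have hsum := Multiset.sum_le_card_nsmul _ 1 hbound
    simp only [Multiset.card_map, card_roots_gapPolynomial (show 2 ≤ n by omega)] at hsum
    refine (norm_multiset_sum_le _).trans (hsum.trans_eq ?_)
    simp
  rw [gapPowerSum_two_mul_add_three hn] at hle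
  have : ‖(2 * n + 4 : ℂ)‖ = 2 * n + 4 := by
    have := Complex.norm_natCast (2 * n + 4)
    push_cast at this
    exact this
  linarith

end SelfReciprocal

/-! ### The semigroups and their invariants -/

namespace NumericalSemigroup

/-- The numerical semigroup `{0, n, n + 1, …, 2 n - 2} ∪ {2 n, 2 n + 1, …}`. -/
def punctured (n : ℕ) (hn : 1 ≤ n) : NumericalSemigroup where
  carrier := {m | m = 0 ∨ (n ≤ m ∧ m ≠ 2 * n - 1)}
  zero_mem' := Or.inl rfl
  add_mem' := by
    intro a b ha hb
    simp only [Set.mem_ofPred_eq] at *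
    omega
  finite_compl := (Set.finite_Iio (2 * n)).subset fun m hm => by
    simp only [Set.mem_compl_iff, Set.mem_ofPred_eq, Set.mem_Iio] at *
    omega

variable {n : ℕ} {hn : 1 ≤ n}

theorem mem_punctured {m : ℕ} :
    m ∈ (punctured n hn).carrier ↔ m = 0 ∨ (n ≤ m ∧ m ≠ 2 * n - 1) := Iff.rfl

theorem frobeniusNumber_punctured :
    (punctured n hn).frobeniusNumber = ((2 * n - 1 : ℕ) : ℤ) := by
  refine (isGreatest_frobeniusNumber _).unique ⟨?_, fun z hz => ?_⟩
  · rintro ⟨m, hm, h⟩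
    rw [mem_punctured] at hm
    omega
  · by_contra! h
    exact hz ⟨z.toNat, mem_punctured.2 (by omega), by omega⟩

/-- The reflection z ↦ 2n - 1 - z swaps 0 with 2n - 1, [n, 2n - 2] with [1, n - 1], and the integers
from 2n on with the negative ones. -/
theorem isSymmetric_punctured : (punctured n hn).IsSymmetric := by
  rw [IsSymmetric, frobeniusNumber_punctured, Set.eq_univ_iff_forall]
  intro z
  by_cases hz : z = 0 ∨ ((n : ℤ) ≤ z ∧ z ≠ 2 * n - 1)
  · exact Or.inl ⟨z.toNat, mem_punctured.2 (by omega), by omega⟩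
  · exact Or.inr ⟨(2 * n - 1 - z).toNat, mem_punctured.2 (by omega), by dsimp only; omega⟩

theorem minimalGenerators_punctured (h3 : 3 ≤ n) :
    (punctured n hn).minimalGenerators = Set.Ico n (2 * n - 1) := by
  ext m
  simp only [minimalGenerators, mem_punctured, Set.mem_ofPred_eq, Set.mem_Ico]
  constructor
  · rintro ⟨hm, hm0, h⟩
    by_contra hlt
    -- An element m ≥ 2n splits as n + (m - n), unless m - n is the gap 2n - 1.
    by_cases hc : m = 3 * n - 1
    · exact h (n + 1) (by omega) (2 * n - 2) (by omega) (by omega) (by omega) (by omega)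
    · exact h n (by omega) (m - n) (by omega) (by omega) (by omega) (by omega)
  · intro hm
    refine ⟨by omega, by omega, fun a ha b hb ha0 hb0 => by omega⟩

theorem embeddingDimension_punctured (h3 : 3 ≤ n) :
    (punctured n hn).embeddingDimension = n - 1 := by
  rw [embeddingDimension, minimalGenerators_punctured h3, ← Finset.coe_Ico, Set.ncard_coe_finset,
    Nat.card_Ico]
  omega

theorem gaps_punctured :
    (punctured n hn).gaps = insert (2 * n - 1) ((Finset.range n).erase 0) := by
  ext m
  simp only [gaps, Set.Finite.mem_toFinset, Set.mem_compl_iff, mem_punctured, Finset.mem_insert,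
    Finset.mem_erase, Finset.mem_range]
  omega

theorem semigroupPolynomial_punctured (h2 : 2 ≤ n) :
    (punctured n hn).semigroupPolynomial = gapPolynomial ℤ n := by
  -- Completing 1, …, n - 1 by 0 gives a geometric sum, which telescopes against X - 1.
  rw [semigroupPolynomial, gaps_punctured, Finset.sum_insert (by simp; omega),
    Finset.sum_erase_eq_sub (by simp; omega), mul_add, mul_sub, mul_geom_sum, gapPolynomial,
    sub_mul, ← pow_succ', show 2 * n - 1 + 1 = 2 * n by omega]
  ring

theorem not_isCyclotomic_punctured (h5 : 5 ≤ n) : ¬ (punctured n hn).IsCyclotomic := by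
  rw [IsCyclotomic, semigroupPolynomial_punctured (by omega)]
  exact not_isKronecker_gapPolynomial h5

end NumericalSemigroup

open NumericalSemigroup in
theorem mainTheorem1 :
    (∀ k : ℕ, 4 ≤ k → ∃ S : NumericalSemigroup,
      S.IsSymmetric ∧ S.embeddingDimension = k ∧ ¬ S.IsCyclotomic) ∧
    (∀ F : ℕ, Odd F → 9 ≤ F → ∃ S : NumericalSemigroup,
      S.IsSymmetric ∧ S.frobeniusNumber = (F : ℤ) ∧ ¬ S.IsCyclotomic) := by
  constructor
  · intro k hk
    exact ⟨punctured (k + 1) (by omega), isSymmetric_punctured,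
      embeddingDimension_punctured (by omega), not_isCyclotomic_punctured (by omega)⟩
  · rintro F ⟨r, rfl⟩ hF
    refine ⟨punctured (r + 1) (by omega), isSymmetric_punctured, ?_,
      not_isCyclotomic_punctured (by omega)⟩
    rw [frobeniusNumber_punctured]
    congr 1
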